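/- Let $n,k\ge 0$ be integers, let $x,x_0,x_1,\dots,x_n$ be $n+2$ pairwise distinct points of an interval $[p,q]$, and let $f\in C^{n+k+1}[p,q]$ be real-valued (derivatives at $p$ and $q$ being one-sided). For $0\le i\le n$ and $0\le m\le k$ put $$L_i(x)=\prod_{\substack{0\le j\le n\\ j\ne i}}\frac{x-x_j}{x_i-x_j},\qquad \rho_m(x)=\sum_{i=0}^n\frac{1}{(x_i-x)^m}\,L_i(x).$$ Then $\rho_0(x)=1$, and the following hold. (i) $$\sum_{m=0}^{k}\frac{f^{(k-m)}(x)}{(k-m)!}\,\rho_m(x)=\sum_{i=0}^n\frac{f(x_i)}{(x_i-x)^k}\,L_i(x)+f[\underbrace{x,\dots,x}_{k+1\text{ times}},x_0,x_1,\dots,x_n]\prod_{i=0}^n(x-x_i).$$ (ii) There is a point $\xi$ in the smallest closed interval containing $x,x_0,\dots,x_n$ such that $$f[\underbrace{x,\dots,x}_{k+1\text{ times}},x_0,\dots,x_n]=\frac{f^{(n+k+1)}(\xi)}{(n+k+1)!},$$ and, with the same $\xi$, $$\sum_{m=0}^{k}\frac{f^{(k-m)}(x)}{(k-m)!}\,\rho_m(x)=\sum_{i=0}^n\frac{f(x_i)}{(x_i-x)^k}\,L_i(x)+\frac{f^{(n+k+1)}(\xi)}{(n+k+1)!}\prod_{i=0}^n(x-x_i).$$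 Here $f[t_0,\dots,t_m]$ is the divided difference with repeated arguments allowed: it is symmetric in its arguments and, for $t_0\le\dots\le t_m$, equals $f^{(m)}(t_0)/m!$ if $t_0=t_m$, and $\dfrac{f[t_1,\dots,t_m]-f[t_0,\dots,t_{m-1}]}{t_m-t_0}$ if $t_0<t_m$. -/

import Mathlib

namespace NumDiff

/-- Divided difference of `f` over a list of points in nondecreasing order, repetitions allowed.
If the first and the last point coincide, then all `m + 1` points are one point `a`, and the value
is `f⁽ᵐ⁾(a) / m!`. Otherwise it is the divided difference quotient
`(f[t₁, …, tₘ] - f[t₀, …, tₘ₋₁]) / (tₘ - t₀)`. Derivatives are taken within `S`, so that they are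
one-sided at an end point of an interval `S`. -/
noncomputable def dividedDiffList (S : Set ℝ) (f : ℝ → ℝ) : List ℝ → ℝ
  | [] => 0
  | a :: l =>
    if (a :: l).getLast (List.cons_ne_nil a l) = a then
      iteratedDerivWithin l.length f S a / (l.length.factorial : ℝ)
    else
      (dividedDiffList S f l - dividedDiffList S f (a :: l).dropLast) /
        ((a :: l).getLast (List.cons_ne_nil a l) - a)
termination_by l => l.length
decreasing_by all_goals simp

/-- The (confluent) divided difference of `f` over a finite multiset of points of `S`, that is, over
finitely many points with repetitions in an arbitrary order. -/
noncomputable def dividedDiff (S : Set ℝ) (f : ℝ → ℝ) (s : Multiset ℝ) : ℝ :=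
  dividedDiffList S f (s.sort (· ≤ ·))

/-- `L_i(x) = ∏_{j ≠ i} (x - x_j) / (x_i - x_j)`. -/
noncomputable def L {n : ℕ} (node : Fin (n + 1) → ℝ) (i : Fin (n + 1)) (x : ℝ) : ℝ :=
  (Lagrange.basis Finset.univ node i).eval x

/-- `ρ_m(x) = ∑_i L_i(x) / (x_i - x)^m`. -/
noncomputable def rho {n : ℕ} (node : Fin (n + 1) → ℝ) (m : ℕ) (x : ℝ) : ℝ :=
  ∑ i, 1 / (node i - x) ^ m * L node i x

/-- The points `x, …, x, x_0, …, x_n`, where `x` is listed `k + 1` times. -/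
def points {n : ℕ} (node : Fin (n + 1) → ℝ) (k : ℕ) (x : ℝ) : Multiset ℝ :=
  Multiset.replicate (k + 1) x + Finset.univ.val.map node

end NumDiff

namespace NumDiff

open Polynomial

/-! Formula (i) sees `f` only through its derivatives of order at most `k` at `x`, its values at the
nodes, and the divided difference. All of these are shared by the Hermite interpolant `P` of degree
at most `n + k + 1`, whose coefficient of degree `n + k + 1` is the divided difference
(`exists_hermite_interpolant`). So it suffices to treat polynomials (`sum_taylor_coeff_mul_rho`).
For `P = ∑ c_j (t - x)^j`, divide the nodal values by `(x_i - x)^k` and sum against `L_i(x)`. The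
terms `j ≤ k` give the `ρ_m`. The terms `k < j ≤ n + k` vanish, because Lagrange interpolation
reproduces `(t - x)^(j - k)`, which is zero at `x`. The top term gives minus the nodal product. For
(ii), `f - P` vanishes to order `k + 1` at `x` and simply at the `n + 1` nodes, so repeated use of
Rolle's theorem gives a zero of its derivative of order `n + k + 1`. -/

/-! ### Rolle's theorem with multiplicities -/

/-- Rolle's theorem for several zeros: `n + 1` zeros of `g` yield `n` new zeros of its derivative. -/
theorem exists_zeros_deriv {H : Set ℝ} (hH : H.OrdConnected) {g g' : ℝ → ℝ}
    (hg : ∀ t ∈ H, HasDerivWithinAt g (g' t) H t) {n : ℕ} (Z : Finset ℝ) (hZ : ↑Z ⊆ H)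
    (hcard : Z.card = n + 1) (hzero : ∀ z ∈ Z, g z = 0) :
    ∃ Z' : Finset ℝ, Z'.card = n ∧ ↑Z' ⊆ H ∧ Disjoint Z Z' ∧ ∀ z ∈ Z', g' z = 0 := by
  classical
  set e := Z.orderEmbOfFin hcard with he
  have heZ : ∀ i, e i ∈ Z := fun i => Finset.orderEmbOfFin_mem Z hcard i
  have key : ∀ i : Fin n, ∃ c ∈ Set.Ioo (e i.castSucc) (e i.succ), g' c = 0 := by
    intro i
    have hsub : Set.Icc (e i.castSucc) (e i.succ) ⊆ H :=
      hH.out (hZ (heZ _)) (hZ (heZ _))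
    refine exists_hasDerivAt_eq_zero (f := g) (e.strictMono i.castSucc_lt_succ) ?_ ?_ ?_
    · exact fun t ht => ((hg t (hsub ht)).continuousWithinAt).mono hsub
    · rw [hzero _ (heZ _), hzero _ (heZ _)]
    · intro t ht
      exact (hg t (hsub (Set.Ioo_subset_Icc_self ht))).hasDerivAt
        (Filter.mem_of_superset (Icc_mem_nhds ht.1 ht.2) hsub)
  choose c hc hc0 using key
  have hmono : StrictMono c := by
    intro i j hij
    refine (hc i).2.trans_le (le_trans ?_ (hc j).1.le)
    exact e.monotone (by simpa [Fin.le_def] using hij)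
  refine ⟨Finset.univ.map ⟨c, hmono.injective⟩, by simp, ?_, ?_, ?_⟩
  · intro t ht
    simp only [Finset.coe_map, Function.Embedding.coeFn_mk, Finset.coe_univ, Set.image_univ,
      Set.mem_range] at ht
    obtain ⟨i, rfl⟩ := ht
    exact hH.out (hZ (heZ _)) (hZ (heZ _)) (Set.Ioo_subset_Icc_self (hc i))
  · rw [Finset.disjoint_left]
    intro z hz hz'
    simp only [Finset.mem_map, Function.Embedding.coeFn_mk, Finset.mem_univ, true_and] at hz'
    obtain ⟨i, rfl⟩ := hz'
    -- `c i` lies strictly between consecutive elements of `Z`; were it the `m`-th element, then `i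
    -- < m < i + 1`.
    have hr : c i ∈ Set.range e := by rw [he, Finset.range_orderEmbOfFin]; exact hz
    obtain ⟨m, hm⟩ := hr
    have h1 := (hc i).1
    have h2 := (hc i).2
    rw [← hm, e.lt_iff_lt, Fin.lt_def] at h1 h2
    simp at h1 h2
    omega
  · intro z hz
    simp only [Finset.mem_map, Function.Embedding.coeFn_mk, Finset.mem_univ, true_and] at hz
    obtain ⟨i, rfl⟩ := hz
    exact hc0 i

/-- Iterated Rolle theorem for `n + 1` simple zeros. -/
theorem exists_zero_iterate_deriv {H : Set ℝ} (hH : H.OrdConnected) {n : ℕ} :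
    ∀ {G : ℕ → ℝ → ℝ} (_ : ∀ j < n, ∀ t ∈ H, HasDerivWithinAt (G j) (G (j + 1) t) H t)
      (Z : Finset ℝ) (_ : ↑Z ⊆ H) (_ : Z.card = n + 1) (_ : ∀ z ∈ Z, G 0 z = 0),
      ∃ ξ ∈ H, G n ξ = 0 := by
  induction n with
  | zero =>
    intro G _ Z hZ hcard hzero
    obtain ⟨z, hz⟩ := Finset.card_pos.1 (by omega : 0 < Z.card)
    exact ⟨z, hZ hz, hzero z hz⟩
  | succ n ih =>
    intro G hG Z hZ hcard hzero
    obtain ⟨Z', hc', hZ', -, hz'⟩ :=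
      exists_zeros_deriv hH (hG 0 (by omega)) Z hZ hcard hzero
    exact ih (G := fun j => G (j + 1)) (fun j hj => hG (j + 1) (by omega)) Z' hZ' hc' hz'

/-- Iterated Rolle theorem for a zero of multiplicity `k` and `n + 1` further simple zeros. -/
theorem exists_zero_iterate_deriv_of_multiple {H : Set ℝ} (hH : H.OrdConnected) {x : ℝ}
    (hx : x ∈ H) {n k : ℕ} :
    ∀ {G : ℕ → ℝ → ℝ} (_ : ∀ j < n + k, ∀ t ∈ H, HasDerivWithinAt (G j) (G (j + 1) t) H t)
      (_ : ∀ j < k, G j x = 0) (Z : Finset ℝ) (_ : ↑Z ⊆ H) (_ : x ∉ Z) (_ : Z.card = n + 1)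
      (_ : ∀ z ∈ Z, G 0 z = 0), ∃ ξ ∈ H, G (n + k) ξ = 0 := by
  classical
  induction k with
  | zero =>
    intro G hG _ Z hZ _ hcard hzero
    exact exists_zero_iterate_deriv hH hG Z hZ hcard hzero
  | succ k ih =>
    intro G hG hGx Z hZ hxZ hcard hzero
    obtain ⟨Z', hc', hZ', hdisj, hz'⟩ :=
      exists_zeros_deriv hH (hG 0 (by omega)) (insert x Z)
        (by rw [Finset.coe_insert]; exact Set.insert_subset hx hZ)
        (by rw [Finset.card_insert_of_notMem hxZ, hcard])
        (fun z hz => by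
          rcases Finset.mem_insert.1 hz with rfl | hz
          · exact hGx 0 (by omega)
          · exact hzero z hz)
    -- Differentiation lowers the multiplicity at `x` by one and keeps `n + 1` other zeros;
    -- disjointness keeps `x` out of `Z'`.
    exact ih (G := fun j => G (j + 1)) (fun j hj => hG (j + 1) (by omega))
      (fun j hj => hGx (j + 1) (by omega)) Z' hZ'
      (Finset.disjoint_left.1 hdisj (Finset.mem_insert_self x Z)) hc' hz'

/-! ### Hermite interpolation and divided differences -/

/-- Since `X - t = (X - a) + (a - t)`, multiplication mixes only neighbouring Taylor coefficients.
This carries the interpolation conditions through a Neville step. -/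
theorem taylor_X_sub_C_mul_coeff (a t : ℝ) (P : ℝ[X]) (j : ℕ) :
    (taylor a ((X - C t) * P)).coeff j =
      (a - t) * (taylor a P).coeff j + if j = 0 then 0 else (taylor a P).coeff (j - 1) := by
  have h : taylor a (X - C t) = X + C (a - t) := by
    simp [taylor_X, taylor_C, C_sub]; ring
  rw [taylor_mul, h, add_mul, coeff_add, coeff_C_mul]
  rcases j with _ | j
  · simp
  · simp [coeff_X_mul, add_comm]

/-- Hermite interpolation by Neville's scheme; the leading coefficient is the divided difference. -/
theorem exists_hermite_interpolant (S : Set ℝ) (f : ℝ → ℝ) (m : ℕ) :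
    ∀ l : List ℝ, l.Pairwise (· ≤ ·) → l.length = m + 1 →
      ∃ P : ℝ[X], P.natDegree ≤ m ∧ P.coeff m = dividedDiffList S f l ∧
        ∀ a, ∀ j < l.count a,
          (taylor a P).coeff j = iteratedDerivWithin j f S a / (j.factorial : ℝ) := by
  induction m with
  | zero =>
    intro l _ hlen
    obtain ⟨a, rfl⟩ := List.length_eq_one_iff.1 hlen
    refine ⟨C (f a), by simp, by simp [dividedDiffList], ?_⟩
    intro b j hj
    rw [List.count_singleton] at hj
    split_ifs at hj with h
    · obtain rfl : a = b := by simpa using h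
      obtain rfl : j = 0 := by omega
      simp
    · omega
  | succ m ih =>
    intro l hl hlen
    obtain ⟨a, l, rfl⟩ := List.exists_cons_of_length_eq_add_one hlen
    have hlen' : l.length = m + 1 := by simpa using hlen
    by_cases hlast : (a :: l).getLast (List.cons_ne_nil a l) = a
    · have hall : ∀ b ∈ a :: l, b = a := by
        intro b hb
        apply le_antisymm
        · have := hl.rel_getLast hb
          rwa [hlast] at this
        · rcases List.mem_cons.1 hb with rfl | hb
          · exact le_rfl
          · exact List.rel_of_pairwise_cons hl hb
      -- All points coincide, so the interpolant is the Taylor polynomial `Q(X - a)`.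
      set Q : ℝ[X] := ∑ i ∈ Finset.range (m + 2),
        C (iteratedDerivWithin i f S a / (i.factorial : ℝ)) * X ^ i with hQ
      have hQc : ∀ j < m + 2, Q.coeff j = iteratedDerivWithin j f S a / (j.factorial : ℝ) := by
        intro j hj
        rw [hQ, finsetSum_coeff]
        simp only [coeff_C_mul_X_pow]
        simp [hj]
      have hQd : Q.natDegree ≤ m + 1 := by
        refine natDegree_sum_le_of_forall_le _ _ fun i hi => ?_
        exact (natDegree_C_mul_X_pow_le _ _).trans (by simp at hi; omega)
      have hTd : (taylor (-a) Q).natDegree ≤ m + 1 := by rwa [natDegree_taylor]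
      refine ⟨taylor (-a) Q, hTd, ?_, ?_⟩
      · have hcoeff : (taylor (-a) Q).coeff (m + 1) = Q.coeff (m + 1) := by
          rcases hQd.lt_or_eq with h | h
          · rw [coeff_eq_zero_of_natDegree_lt h,
              coeff_eq_zero_of_natDegree_lt (by rwa [natDegree_taylor])]
          · rw [← h, coeff_taylor_natDegree, leadingCoeff]
        rw [hcoeff, hQc _ (by omega), dividedDiffList, if_pos hlast, hlen']
      · intro b j hj
        have hb : b = a := hall b (List.count_pos_iff.1 (by omega))
        subst hb
        rw [taylor_taylor]
        have := (List.count_le_length (a := b) (l := b :: l))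
        simp only [add_neg_cancel, taylor_zero]
        exact hQc j (by omega)
    · set b := (a :: l).getLast (List.cons_ne_nil a l) with hb
      have hab : b - a ≠ 0 := sub_ne_zero.2 hlast
      have hdec : (a :: l).dropLast ++ [b] = a :: l := List.dropLast_append_getLast _
      obtain ⟨P₁, hd₁, hc₁, hi₁⟩ := ih l (List.Pairwise.of_cons hl) hlen'
      obtain ⟨P₀, hd₀, hc₀, hi₀⟩ := ih (a :: l).dropLast
        (hl.sublist (List.dropLast_sublist _)) (by simp [hlen'])
      have hcnt₁ : ∀ t, (a :: l).count t = l.count t + if a = t then 1 else 0 := by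
        intro t; rw [List.count_cons]; simp
      have hcnt₀ : ∀ t, (a :: l).count t = (a :: l).dropLast.count t + if b = t then 1 else 0 := by
        intro t
        conv_lhs => rw [← hdec, List.count_append, List.count_singleton]
        simp
      -- Neville's combination: `P₁` omits one copy of `a` and `P₀` one copy of `b`.
      refine ⟨C (b - a)⁻¹ * ((X - C a) * P₁ - (X - C b) * P₀), ?_, ?_, ?_⟩
      · refine (natDegree_C_mul_le _ _).trans ((natDegree_sub_le _ _).trans (max_le ?_ ?_))
        · refine natDegree_mul_le.trans ?_
          rw [natDegree_X_sub_C]; omega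
        · refine natDegree_mul_le.trans ?_
          rw [natDegree_X_sub_C]; omega
      · rw [dividedDiffList, if_neg hlast, ← hc₁, ← hc₀, coeff_C_mul, coeff_sub, sub_mul, sub_mul,
          coeff_sub, coeff_sub, coeff_X_mul, coeff_X_mul, coeff_C_mul, coeff_C_mul,
          coeff_eq_zero_of_natDegree_lt (by omega : P₁.natDegree < m + 1),
          coeff_eq_zero_of_natDegree_lt (by omega : P₀.natDegree < m + 1)]
        simp only [mul_zero, sub_zero]
        rw [div_eq_inv_mul]
      · intro t j hj
        have e₁ := hcnt₁ t
        have e₀ := hcnt₀ t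
        have hT : taylor t (C (b - a)⁻¹ * ((X - C a) * P₁ - (X - C b) * P₀)) =
            C (b - a)⁻¹ * (taylor t ((X - C a) * P₁) - taylor t ((X - C b) * P₀)) := by
          rw [taylor_mul, taylor_C, map_sub]
        rw [hT, coeff_C_mul, coeff_sub, taylor_X_sub_C_mul_coeff, taylor_X_sub_C_mul_coeff,
          inv_mul_eq_iff_eq_mul₀ hab]
        -- At `t = a` the interpolant `P₁` may miss the order `j`, but there the factor `t - a` is
        -- zero; likewise for `P₀` at `b`.
        have k₁ : (t - a) * (taylor t P₁).coeff j =
            (t - a) * (iteratedDerivWithin j f S t / (j.factorial : ℝ)) := by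
          by_cases h : a = t
          · simp [h]
          · rw [hi₁ t j (by rw [if_neg h] at e₁; omega)]
        have k₀ : (t - b) * (taylor t P₀).coeff j =
            (t - b) * (iteratedDerivWithin j f S t / (j.factorial : ℝ)) := by
          by_cases h : b = t
          · simp [h]
          · rw [hi₀ t j (by rw [if_neg h] at e₀; omega)]
        -- Dropping one point costs at most one order, so both interpolants match `f` at order `j -
        -- 1` and the shifted terms cancel.
        have k₂ : (if j = 0 then 0 else (taylor t P₁).coeff (j - 1)) =
            if j = 0 then 0 else (taylor t P₀).coeff (j - 1) := by
          by_cases h : j = 0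
          · simp [h]
          · rw [if_neg h, if_neg h, hi₁ t (j - 1) (by split_ifs at e₁ <;> omega),
              hi₀ t (j - 1) (by split_ifs at e₀ <;> omega)]
        rw [k₁, k₀, k₂]
        ring

/-! ### Lagrange sums and the formula for polynomials -/

section Lagrange

variable {n : ℕ} {node : Fin (n + 1) → ℝ}

/-- Lagrange interpolation reproduces polynomials of degree at most `n`. -/
theorem sum_eval_mul_L (hinj : Function.Injective node) (x : ℝ) {Q : ℝ[X]}
    (hQ : Q.degree < (n + 1 : ℕ)) : ∑ i, Q.eval (node i) * L node i x = Q.eval x := by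
  have h := Lagrange.eq_interpolate (s := Finset.univ) (v := node) (f := Q)
    hinj.injOn (by simpa using hQ)
  conv_rhs => rw [h]
  rw [Lagrange.interpolate_apply, eval_finsetSum]
  simp [L]

theorem sum_pow_mul_L_eq_zero (hinj : Function.Injective node) (x : ℝ) {r : ℕ} (hr : 0 < r)
    (hrn : r ≤ n) : ∑ i, (node i - x) ^ r * L node i x = 0 := by
  have h := sum_eval_mul_L hinj x (Q := (X - C x) ^ r) (by
    rw [degree_pow, degree_X_sub_C]
    simpa using mod_cast (by omega : r < n + 1))
  simpa [hr.ne'] using h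

/-- `(t - x)^(n+1)` and `∏ (t - x_i)` are both monic of degree `n + 1`, so their difference is
reproduced exactly. The product vanishes at the nodes, the power at `x`. -/
theorem sum_pow_succ_mul_L (hinj : Function.Injective node) (x : ℝ) :
    ∑ i, (node i - x) ^ (n + 1) * L node i x = -∏ i, (x - node i) := by
  have hdeg : ((X - C x) ^ (n + 1) - ∏ i, (X - C (node i)) : ℝ[X]).degree < (n + 1 : ℕ) := by
    have h1 : ((X - C x) ^ (n + 1) : ℝ[X]).degree = (n + 1 : ℕ) := by
      rw [degree_pow, degree_X_sub_C]; simp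
    rw [← h1]
    apply degree_sub_lt_left
    · rw [h1, degree_prod]; simp
    · exact pow_ne_zero _ (X_sub_C_ne_zero x)
    · rw [((monic_X_sub_C x).pow _).leadingCoeff,
        (monic_prod_of_monic _ _ fun i _ => monic_X_sub_C _).leadingCoeff]
  have h := sum_eval_mul_L hinj x hdeg
  have h0 : ∀ i, ∏ j, (node i - node j) = 0 := fun i =>
    Finset.prod_eq_zero (Finset.mem_univ i) (sub_self _)
  simpa [eval_prod, h0] using h

theorem rho_zero (hinj : Function.Injective node) (x : ℝ) : rho node 0 x = 1 := by
  have h := sum_eval_mul_L hinj x (Q := 1) (by rw [degree_one]; exact_mod_cast n.succ_pos)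
  simpa [rho] using h

/-- The numerical differentiation formula for polynomials. -/
theorem sum_taylor_coeff_mul_rho (hinj : Function.Injective node) {x : ℝ}
    (hne : ∀ i, x ≠ node i) (k : ℕ) {P : ℝ[X]} (hP : P.natDegree ≤ n + k + 1) :
    ∑ m ∈ Finset.range (k + 1), (taylor x P).coeff (k - m) * rho node m x =
      ∑ i, P.eval (node i) / (node i - x) ^ k * L node i x +
        P.coeff (n + k + 1) * ∏ i, (x - node i) := by
  set c := (taylor x P).coeff with hc
  have hd : ∀ i, node i - x ≠ 0 := fun i => sub_ne_zero.2 (hne i).symm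
  have heval : ∀ t, P.eval t = ∑ j ∈ Finset.range (k + 1 + (n + 1)), c j * (t - x) ^ j := by
    intro t
    have h := taylor_eval_sub x P t
    rw [← h, eval_eq_sum_range' (n := k + 1 + (n + 1)) (by rw [natDegree_taylor]; omega)]
  have hlead : c (n + k + 1) = P.coeff (n + k + 1) := by
    rcases hP.lt_or_eq with h | h
    · rw [hc, coeff_eq_zero_of_natDegree_lt h,
        coeff_eq_zero_of_natDegree_lt (by rwa [natDegree_taylor])]
    · rw [hc, ← h, coeff_taylor_natDegree, leadingCoeff]
  have hlow : ∑ m ∈ Finset.range (k + 1), c (k - m) * rho node m x =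
      ∑ i, (∑ j ∈ Finset.range (k + 1), c j * (node i - x) ^ j) /
        (node i - x) ^ k * L node i x := by
    rw [← Finset.sum_range_reflect]
    simp only [rho, Finset.sum_div, Finset.sum_mul, Finset.mul_sum]
    rw [Finset.sum_comm]
    refine Finset.sum_congr rfl fun i _ => Finset.sum_congr rfl fun j hj => ?_
    have hjk : j ≤ k := by simpa [Nat.lt_succ_iff] using hj
    have e1 : k + 1 - 1 - j = k - j := by omega
    have e2 : k - (k - j) = j := by omega
    rw [e1, e2]
    have h3 : (node i - x) ^ k = (node i - x) ^ (k - j) * (node i - x) ^ j := by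
      rw [← pow_add]; congr 1; omega
    rw [h3]
    have := hd i
    field_simp
  have hhigh : ∑ i, (∑ r ∈ Finset.range (n + 1), c (k + 1 + r) * (node i - x) ^ (k + 1 + r)) /
        (node i - x) ^ k * L node i x = -(P.coeff (n + k + 1) * ∏ i, (x - node i)) := by
    have h1 : ∀ i, (∑ r ∈ Finset.range (n + 1), c (k + 1 + r) * (node i - x) ^ (k + 1 + r)) /
        (node i - x) ^ k * L node i x =
        ∑ r ∈ Finset.range (n + 1), c (k + 1 + r) * ((node i - x) ^ (r + 1) * L node i x) := by
      intro i
      rw [Finset.sum_div, Finset.sum_mul]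
      refine Finset.sum_congr rfl fun r _ => ?_
      have := hd i
      rw [show k + 1 + r = k + (r + 1) by omega, pow_add]
      field_simp
    simp only [h1]
    rw [Finset.sum_comm]
    simp only [← Finset.mul_sum]
    rw [Finset.sum_range_succ, sum_pow_succ_mul_L hinj, Finset.sum_eq_zero, zero_add,
      show k + 1 + n = n + k + 1 by omega, hlead, mul_neg]
    intro r hr
    rw [sum_pow_mul_L_eq_zero hinj x r.succ_pos (by simp at hr; omega), mul_zero]
  have hsplit : ∑ i, P.eval (node i) / (node i - x) ^ k * L node i x =
      ∑ i, (∑ j ∈ Finset.range (k + 1), c j * (node i - x) ^ j) /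
        (node i - x) ^ k * L node i x +
      ∑ i, (∑ r ∈ Finset.range (n + 1), c (k + 1 + r) * (node i - x) ^ (k + 1 + r)) /
        (node i - x) ^ k * L node i x := by
    rw [← Finset.sum_add_distrib]
    refine Finset.sum_congr rfl fun i _ => ?_
    rw [heval, Finset.sum_range_add, add_div, add_mul]
  rw [hsplit, hlow, hhigh]
  ring

end Lagrange

/-! ### Mean value form and conclusion -/

theorem eval_iterate_derivative_eq (P : ℝ[X]) (a : ℝ) (j : ℕ) :
    (derivative^[j] P).eval a = (j.factorial : ℝ) * (taylor a P).coeff j := by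
  rw [taylor_coeff, ← factorial_smul_hasseDeriv, LinearMap.smul_apply, eval_smul, nsmul_eq_mul]

theorem eval_iterate_derivative_of_natDegree_le {P : ℝ[X]} {N : ℕ} (hP : P.natDegree ≤ N)
    (a : ℝ) : (derivative^[N] P).eval a = (N.factorial : ℝ) * P.coeff N := by
  rw [eval_iterate_derivative_eq]
  congr 1
  rcases hP.lt_or_eq with h | h
  · rw [coeff_eq_zero_of_natDegree_lt h,
      coeff_eq_zero_of_natDegree_lt (by rwa [natDegree_taylor])]
  · rw [← h, coeff_taylor_natDegree, leadingCoeff]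

theorem exists_hermite_interpolant_points {n : ℕ} (S : Set ℝ) (f : ℝ → ℝ)
    (node : Fin (n + 1) → ℝ) (k : ℕ) (x : ℝ) :
    ∃ P : ℝ[X], P.natDegree ≤ n + k + 1 ∧
      P.coeff (n + k + 1) = dividedDiff S f (points node k x) ∧
      (∀ j ≤ k, (taylor x P).coeff j = iteratedDerivWithin j f S x / (j.factorial : ℝ)) ∧
      ∀ i, P.eval (node i) = f (node i) := by
  have hcount : ∀ t, ((points node k x).sort (· ≤ ·)).count t = (points node k x).count t := by
    intro t
    conv_rhs => rw [← Multiset.sort_eq (points node k x) (· ≤ ·)]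
    rw [Multiset.coe_count]
  obtain ⟨P, hd, hc, hi⟩ := exists_hermite_interpolant S f (n + k + 1)
    ((points node k x).sort (· ≤ ·)) (Multiset.pairwise_sort _ _)
    (by rw [Multiset.length_sort]; simp [points]; omega)
  refine ⟨P, hd, hc, fun j hj => hi x j ?_, fun i => ?_⟩
  · rw [hcount, points, Multiset.count_add, Multiset.count_replicate_self]
    omega
  · have h := hi (node i) 0 (by
      rw [hcount, Multiset.count_pos, points, Multiset.mem_add]
      exact Or.inr (Multiset.mem_map_of_mem _ (Finset.mem_univ i)))
    simpa using h

/-- The mean value form of the leading coefficient of a Hermite interpolant. -/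
theorem exists_iteratedDerivWithin_eq_coeff {n k : ℕ} {p q x : ℝ} {node : Fin (n + 1) → ℝ}
    {f : ℝ → ℝ} (hpq : p < q)
    (hx : x ∈ Set.Icc p q) (hnode : ∀ i, node i ∈ Set.Icc p q)
    (hinj : Function.Injective node) (hne : ∀ i, x ≠ node i)
    (hf : ContDiffOn ℝ ((n + k + 1 : ℕ) : WithTop ℕ∞) f (Set.Icc p q)) {P : ℝ[X]}
    (hP : P.natDegree ≤ n + k + 1)
    (hPx : ∀ j ≤ k, (taylor x P).coeff j =
      iteratedDerivWithin j f (Set.Icc p q) x / (j.factorial : ℝ))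
    (hPn : ∀ i, P.eval (node i) = f (node i)) :
    ∃ ξ ∈ convexHull ℝ (insert x (Set.range node)),
      P.coeff (n + k + 1) =
        iteratedDerivWithin (n + k + 1) f (Set.Icc p q) ξ / ((n + k + 1).factorial : ℝ) := by
  set S := Set.Icc p q with hS
  set H := convexHull ℝ (insert x (Set.range node)) with hH
  have hsub : insert x (Set.range node) ⊆ H := subset_convexHull ℝ _
  have hHS : H ⊆ S := convexHull_min
    (Set.insert_subset hx (Set.range_subset_iff.2 hnode)) (convex_Icc p q)
  have hfac : ∀ j : ℕ, (j.factorial : ℝ) ≠ 0 := fun j => by positivity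
  obtain ⟨ξ, hξ, h0⟩ := exists_zero_iterate_deriv_of_multiple (n := n) (k := k + 1)
    (convex_convexHull ℝ _).ordConnected (hsub (Set.mem_insert x _))
    (G := fun j t => iteratedDerivWithin j f S t - (derivative^[j] P).eval t)
    (fun j hj t ht => by
      refine HasDerivWithinAt.sub ?_ ?_
      · have hd := (hf.differentiableOn_iteratedDerivWithin (m := j) (by exact_mod_cast hj)
          (uniqueDiffOn_Icc hpq) t (hHS ht)).hasDerivWithinAt
        rw [iteratedDerivWithin_succ]
        exact hd.mono hHS
      · rw [Function.iterate_succ_apply']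
        exact (Polynomial.hasDerivAt _ t).hasDerivWithinAt)
    (fun j hj => by
      rw [eval_iterate_derivative_eq, hPx j (by omega), mul_div_cancel₀ _ (hfac j), sub_self])
    (Finset.univ.map ⟨node, hinj⟩)
    (fun t ht => by
      simp only [Finset.coe_map, Function.Embedding.coeFn_mk, Finset.coe_univ, Set.image_univ] at ht
      exact hsub (Set.mem_insert_of_mem x ht))
    (by simpa using fun i => (hne i).symm)
    (by simp)
    (fun z hz => by
      simp only [Finset.mem_map, Function.Embedding.coeFn_mk, Finset.mem_univ, true_and] at hz
      obtain ⟨i, rfl⟩ := hz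
      simp [hPn])
  refine ⟨ξ, hξ, ?_⟩
  rw [← add_assoc] at h0
  rw [eval_iterate_derivative_of_natDegree_le hP, sub_eq_zero] at h0
  rw [h0, mul_div_cancel_left₀ _ (hfac _)]

end NumDiff

theorem theorem4p1 (n k : ℕ) (p q x : ℝ) (node : Fin (n + 1) → ℝ) (f : ℝ → ℝ)
    (hx : x ∈ Set.Icc p q) (hnode : ∀ i, node i ∈ Set.Icc p q)
    (hinj : Function.Injective node) (hne : ∀ i, x ≠ node i)
    (hf : ContDiffOn ℝ ((n + k + 1 : ℕ) : WithTop ℕ∞) f (Set.Icc p q)) :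
    NumDiff.rho node 0 x = 1 ∧
    (∑ m ∈ Finset.range (k + 1),
        iteratedDerivWithin (k - m) f (Set.Icc p q) x / ((k - m).factorial : ℝ) *
          NumDiff.rho node m x =
      ∑ i, f (node i) / (node i - x) ^ k * NumDiff.L node i x +
        NumDiff.dividedDiff (Set.Icc p q) f (NumDiff.points node k x) * ∏ i, (x - node i)) ∧
    ∃ ξ ∈ convexHull ℝ (insert x (Set.range node)),
      NumDiff.dividedDiff (Set.Icc p q) f (NumDiff.points node k x) =
          iteratedDerivWithin (n + k + 1) f (Set.Icc p q) ξ / ((n + k + 1).factorial : ℝ) ∧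
      ∑ m ∈ Finset.range (k + 1),
          iteratedDerivWithin (k - m) f (Set.Icc p q) x / ((k - m).factorial : ℝ) *
            NumDiff.rho node m x =
        ∑ i, f (node i) / (node i - x) ^ k * NumDiff.L node i x +
          iteratedDerivWithin (n + k + 1) f (Set.Icc p q) ξ / ((n + k + 1).factorial : ℝ) *
            ∏ i, (x - node i) := by
  -- Two distinct points make the interval nondegenerate, as unique differentiability on it
  -- requires.
  have hpq : p < q := by
    refine lt_of_le_of_ne (hx.1.trans hx.2) ?_
    rintro rfl
    exact hne 0 ((le_antisymm hx.2 hx.1).trans (le_antisymm (hnode 0).2 (hnode 0).1).symm)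
  obtain ⟨P, hP, hPc, hPx, hPn⟩ :=
    NumDiff.exists_hermite_interpolant_points (Set.Icc p q) f node k x
  have hformula := NumDiff.sum_taylor_coeff_mul_rho hinj hne k hP
  -- The interpolation conditions replace `P` by `f` everywhere except in the leading coefficient.
  simp only [hPn, hPx _ (Nat.sub_le k _)] at hformula
  obtain ⟨ξ, hξ, hξP⟩ :=
    NumDiff.exists_iteratedDerivWithin_eq_coeff hpq hx hnode hinj hne hf hP hPx hPn
  refine ⟨NumDiff.rho_zero hinj x, ?_, ξ, hξ, ?_, ?_⟩
  · rw [← hPc, hformula]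
  · rw [← hPc, hξP]
  · rw [← hξP, hformula]
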